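/- All scalars are real. Let $M$ be a metric space with a base point $0\in M$. $\mathrm{Lip}_0(M)$ is the space of all Lipschitz functions $f:M\to\mathbb R$ with $f(0)=0$, normed by the best Lipschitz constant, and $\mathcal F(M)=\overline{\mathrm{span}}\{\delta(x):x\in M\}\subset \mathrm{Lip}_0(M)^*$ is the Lipschitz-free space over $M$, where $\delta(x)(f)=f(x)$. For a non-empty set $S\subset M$ and $C\ge 1$, we say that $S$ is $C$-Lipschitz extendable in $M$ if, after choosing a base point in $S$ for both $S$ and $M$ (the choice is immaterial), there is a bounded linear operator $E:\mathrm{Lip}_0(S)\to\mathrm{Lip}_0(M)$ with $\|E\|\le C$ and $(Ef)(x)=f(x)$ for all $f\in \mathrm{Lip}_0(S)$ and $x\in S$. We say that $S$ is weak$^*$ $C$-Lipschitz extendable in $M$ if $E$ can moreover be chosen weak$^*$-to-weak$^*$ continuous, that is, continuous on bounded sets for the topologies of pointwise convergence. The space $M$ is (metrically) homogeneous if for all $x,y\in M$ there is a bijective isometry $\varphi:M\to M$ with $\varphi(x)=y$. **Theorem.** Let $M$ be homogeneous and unbounded. (1) If there is $C\in[1,\infty)$ such that all closed balls $B(x,r)$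 ($x\in M$, $r>0$) are weak$^*$ $C$-Lipschitz extendable in $M$, then $\mathcal F(M)$ is linearly isomorphic to its countable $\ell_1$-sum $\left(\bigoplus_{\mathbb N}\mathcal F(M)\right)_1$. (2) If there is $C\in[1,\infty)$ such that all closed balls $B(x,r)$ ($x\in M$, $r>0$) are $C$-Lipschitz extendable in $M$, then $\mathrm{Lip}_0(M)$ is linearly isomorphic to its countable $\ell_\infty$-sum $\left(\bigoplus_{\mathbb N}\mathrm{Lip}_0(M)\right)_\infty$. -/

import Mathlib

open scoped ENNReal

noncomputable section

/-- The vector space of all Lipschitz functions `f : M → ℝ` with `f o = 0`. -/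
def lipZeroSubmodule (M : Type*) [MetricSpace M] (o : M) : Submodule ℝ (M → ℝ) where
  carrier := {f | (∃ K : NNReal, LipschitzWith K f) ∧ f o = 0}
  zero_mem' := ⟨⟨0, LipschitzWith.const 0⟩, rfl⟩
  add_mem' := by
    rintro f g ⟨⟨K, hf⟩, hf0⟩ ⟨⟨L, hg⟩, hg0⟩
    exact ⟨⟨K + L, hf.add hg⟩, by simp [hf0, hg0]⟩
  smul_mem' := by
    rintro c f ⟨⟨K, hf⟩, hf0⟩
    refine ⟨⟨‖c‖₊ * K, ?_⟩, by simp [hf0]⟩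
    exact (lipschitzWith_smul c).comp hf

/-- The Lipschitz space `Lip₀(M)` of the metric space `M` with base point `o`. It is a separate
type, so that it carries the Lipschitz norm below and not the topology of the product `M → ℝ`. -/
def LipZero (M : Type*) [MetricSpace M] (o : M) : Type _ := ↥(lipZeroSubmodule M o)

namespace LipZero

variable {M : Type*} [MetricSpace M] {o : M}

instance : AddCommGroup (LipZero M o) := inferInstanceAs (AddCommGroup ↥(lipZeroSubmodule M o))

instance : Module ℝ (LipZero M o) := inferInstanceAs (Module ℝ ↥(lipZeroSubmodule M o))

instance : FunLike (LipZero M o) M ℝ where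
  coe f := f.1
  coe_injective _ _ h := Subtype.ext h

/-- A Lipschitz function that vanishes at the base point, as an element of `Lip₀(M)`. -/
def of (f : M → ℝ) (hf : ∃ K : NNReal, LipschitzWith K f) (h0 : f o = 0) : LipZero M o :=
  ⟨f, hf, h0⟩

theorem of_apply (f : M → ℝ) (hf : ∃ K : NNReal, LipschitzWith K f) (h0 : f o = 0) (x : M) :
    (of f hf h0 : LipZero M o) x = f x := rfl

theorem exists_lipschitzWith (f : LipZero M o) : ∃ K : NNReal, LipschitzWith K f := f.2.1

theorem add_apply (f g : LipZero M o) (x : M) : (f + g) x = f x + g x := rfl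

theorem smul_apply (c : ℝ) (f : LipZero M o) (x : M) : (c • f) x = c * f x := rfl

theorem zero_apply (x : M) : (0 : LipZero M o) x = 0 := rfl

theorem apply_base (f : LipZero M o) : f o = 0 := f.2.2

theorem ext {f g : LipZero M o} (h : ∀ x, f x = g x) : f = g := DFunLike.ext f g h

/-- The best Lipschitz constant, the supremum of `|f x - f y| / d(x, y)`. The pairs with `x = y`
contribute the value `0 / 0 = 0`, which does not change the supremum. -/
instance : Norm (LipZero M o) := ⟨fun f => ⨆ p : M × M, |f p.1 - f p.2| / dist p.1 p.2⟩

theorem norm_def (f : LipZero M o) :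
    ‖f‖ = ⨆ p : M × M, |f p.1 - f p.2| / dist p.1 p.2 := rfl

theorem bddAbove_slopes (f : LipZero M o) :
    BddAbove (Set.range fun p : M × M => |f p.1 - f p.2| / dist p.1 p.2) := by
  obtain ⟨K, hK⟩ := f.exists_lipschitzWith
  refine ⟨K, ?_⟩
  rintro _ ⟨p, rfl⟩
  have h := hK.dist_le_mul p.1 p.2
  rw [Real.dist_eq] at h
  exact div_le_of_le_mul₀ dist_nonneg K.2 h

theorem norm_nonneg' (f : LipZero M o) : 0 ≤ ‖f‖ :=
  Real.iSup_nonneg fun _ => div_nonneg (abs_nonneg _) dist_nonneg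

theorem abs_sub_le (f : LipZero M o) (x y : M) : |f x - f y| ≤ ‖f‖ * dist x y := by
  rcases eq_or_ne x y with rfl | h
  · simp
  · rw [← div_le_iff₀ (dist_pos.2 h)]
    exact le_ciSup f.bddAbove_slopes (x, y)

theorem norm_le_of {f : LipZero M o} {K : ℝ} (hK : 0 ≤ K)
    (h : ∀ x y, |f x - f y| ≤ K * dist x y) : ‖f‖ ≤ K :=
  Real.iSup_le (fun p => div_le_of_le_mul₀ dist_nonneg hK (h p.1 p.2)) hK

theorem abs_apply_le (f : LipZero M o) (x : M) : |f x| ≤ dist x o * ‖f‖ := by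
  have h := f.abs_sub_le x o
  rw [f.apply_base, sub_zero] at h
  linarith

theorem normCore : NormedSpace.Core ℝ (LipZero M o) where
  norm_nonneg := norm_nonneg'
  norm_smul c f := by
    rw [norm_def, norm_def, Real.norm_eq_abs, Real.mul_iSup_of_nonneg (abs_nonneg c)]
    congr 1
    funext p
    rw [smul_apply, smul_apply, ← mul_sub, abs_mul, mul_div_assoc]
  norm_triangle f g := by
    refine norm_le_of (add_nonneg (norm_nonneg' f) (norm_nonneg' g)) fun x y => ?_
    have hf := f.abs_sub_le x y
    have hg := g.abs_sub_le x y
    have h := abs_add_le (f x - f y) (g x - g y)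
    rw [add_apply, add_apply, add_sub_add_comm]
    linarith
  norm_eq_zero_iff f := by
    constructor
    · intro h
      refine ext fun x => ?_
      have hx := f.abs_apply_le x
      rw [h, mul_zero] at hx
      exact abs_nonpos_iff.1 hx
    · rintro rfl
      exact le_antisymm (norm_le_of le_rfl fun x y => by simp [zero_apply]) (norm_nonneg' _)

instance : NormedAddCommGroup (LipZero M o) := NormedAddCommGroup.ofCore normCore

instance : NormedSpace ℝ (LipZero M o) := NormedSpace.ofCore normCore

/-- The evaluation functional `δ(x) ∈ Lip₀(M)*`, `f ↦ f x`. -/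
def delta (o x : M) : StrongDual ℝ (LipZero M o) :=
  LinearMap.mkContinuous
    { toFun := fun f => f x
      map_add' := fun _ _ => rfl
      map_smul' := fun _ _ => rfl }
    (dist x o) (fun f => f.abs_apply_le x)

/-- The topology of pointwise convergence on `Lip₀(M)`. -/
abbrev pointwiseTopology (M : Type*) [MetricSpace M] (o : M) : TopologicalSpace (LipZero M o) :=
  TopologicalSpace.induced (fun f : LipZero M o => (f : M → ℝ)) Pi.topologicalSpace

end LipZero

/-- The Lipschitz-free space `F(M)`: the closed linear span of the evaluation functionals in
`Lip₀(M)*`, with the dual norm. -/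
abbrev LipschitzFree (M : Type*) [MetricSpace M] (o : M) : Type _ :=
  ↥((Submodule.span ℝ (Set.range (LipZero.delta o : M → StrongDual ℝ (LipZero M o)))).topologicalClosure)

/-- `E : Lip₀(S) → Lip₀(M)` is an extension operator: `(E f) x = f x` for all `x ∈ S`. -/
def IsExtensionOperator {M : Type*} [MetricSpace M] {S : Set M} {s : S}
    (E : LipZero S s →L[ℝ] LipZero M (s : M)) : Prop :=
  ∀ (f : LipZero S s) (x : S), E f (x : M) = f x

/-- `E` is weak* continuous, that is, continuous from the topology of pointwise convergence to the
topology of pointwise convergence, on bounded sets (by linearity, on the unit ball). The weak*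
topology given by the Lipschitz-free space agrees with that of pointwise convergence on bounded
sets only; by the Banach-Dieudonné theorem this is the same as weak*-to-weak* continuity, and it is
implied by continuity for the pointwise topologies on the whole of `Lip₀(S)`. -/
def IsWeakStarContinuous {M N : Type*} [MetricSpace M] [MetricSpace N] {o : M} {p : N}
    (E : LipZero M o →L[ℝ] LipZero N p) : Prop :=
  @ContinuousOn _ _ (LipZero.pointwiseTopology M o) (LipZero.pointwiseTopology N p)
    (fun f => E f) {f | ‖f‖ ≤ 1}

/-- `S` is `C`-Lipschitz extendable in `M`. The base point is taken in `S`; its choice is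
immaterial. -/
def IsLipschitzExtendable {M : Type*} [MetricSpace M] (C : ℝ) (S : Set M) : Prop :=
  ∃ (s : S) (E : LipZero S s →L[ℝ] LipZero M (s : M)), IsExtensionOperator E ∧ ‖E‖ ≤ C

/-- `S` is weak* `C`-Lipschitz extendable in `M`. -/
def IsWeakStarLipschitzExtendable {M : Type*} [MetricSpace M] (C : ℝ) (S : Set M) : Prop :=
  ∃ (s : S) (E : LipZero S s →L[ℝ] LipZero M (s : M)),
    IsExtensionOperator E ∧ IsWeakStarContinuous E ∧ ‖E‖ ≤ C

/-- The isometry group of `M` acts transitively on `M`. -/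
def IsMetricallyHomogeneous (M : Type*) [MetricSpace M] : Prop :=
  ∀ x y : M, ∃ φ : M ≃ᵢ M, φ x = y

end

/-!
Write `F` for `LipschitzFree M o` and `Lip₀` for `LipZero M o`. Both parts follow from a
factorization of the identity of `ℓ₁(F)` through `F` (resp. of `ℓ_∞(Lip₀)` through `Lip₀`).
Indeed, if `Z = ℓ_p(A)` is isomorphic to a complemented subspace of `A`, say `A ≅ Z × K`, then
Pełczyński's decomposition gives `Z ≅ A × Z ≅ Z × K × Z ≅ Z × K ≅ A`
(`nonempty_equiv_lp_of_factorization`).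

For the factorization, choose balls `B(z_{n,k}, 2^(k+1))`, `n, k ∈ ℕ`, whose doubles are pairwise
disjoint and avoid `o`, which is possible as `M` is unbounded; by homogeneity there are isometries
`φ_{n,k}` of `M` with `φ_{n,k} o = z_{n,k}`
(`exists_scattered_isometries`). The `n`-th copy of `Lip₀` is to be placed on the balls with first
index `n`, the `k`-th of which carries a copy of `B(o, 2^(k+1))`.

* From the sum into the space (for `Lip₀`): restrict the `n`-th function `g_n` to `B(o, 2^(k+1))`,
  transport it by `φ_{n,k}`, extend it to `M` by the extension operator of the ball, cut it off
  outside the doubled ball, and add everything up. As the supports are disjoint, the sum is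
  Lipschitz.
* Back: from `f`, form the functions `f ∘ φ_{n,k} - f (z_{n,k})` and glue them along dyadic
  shells by a partition of unity `λ_k` that lives on `B(o, 2^(k+1))` (`shellGlue`). On that ball,
  each of them is `g_n` if `f` comes from `(g_n)`, so gluing returns `g_n`.

All operators are encoded by their kernels: a Lipschitz map `s : M → Z*` with `s o = 0` is the same
as an operator `Z → Lip₀` (`LipZero.exists_of_kernel`), and a Lipschitz map `M → Y` that vanishes at
`o` is the same as an operator `F → Y` (`LipschitzFree.exists_lift`). The extension operator of a
ball becomes a Lipschitz map `e : M → Lip₀*` with `e (φ y) = δ(y)` on the ball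
(`exists_ball_kernel`). In the weak* case the values of `e` belong to `F`, because a functional that
is pointwise continuous on the unit ball is a norm limit of combinations of evaluations
(`mem_lipschitzFree_of_small`); hence in that case the construction runs in `F` with all arrows
reversed (`IsLipschitzUniversal.nonempty_equiv_lp_one`).
-/

open scoped ENNReal

noncomputable section

/-! ### Sequence spaces and Pełczyński's decomposition -/

section SequenceSpaces

variable {A : Type*} [NormedAddCommGroup A] [NormedSpace ℝ A] {p : ℝ≥0∞} [Fact (1 ≤ p)]

/-- A linear map on sequences restricts to a bounded operator on `ℓ_p` if it produces no new values
other than `0` (which settles `p = ∞`) and does not increase `q`-th power sums (which settles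
`p < ∞`). -/
theorem lp_exists_clm_of_sum_le (f : (ℕ → A) →ₗ[ℝ] (ℕ → A))
    (hinf : ∀ (z : ℕ → A) (i : ℕ), f z i = 0 ∨ ∃ j, f z i = z j)
    (hsum : ∀ (q : ℝ), 0 < q → ∀ (z : ℕ → A) (s : Finset ℕ), ∃ t : Finset ℕ,
      ∑ i ∈ s, ‖f z i‖ ^ q ≤ ∑ j ∈ t, ‖z j‖ ^ q) :
    ∃ U : lp (fun _ : ℕ => A) p →L[ℝ] lp (fun _ : ℕ => A) p, ∀ z i, U z i = f z i := by
  have hp1 : 1 ≤ p := Fact.out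
  have hp0 : p ≠ 0 := (zero_lt_one.trans_le hp1).ne'
  have hle : ∀ (z : lp (fun _ : ℕ => A) p) (i : ℕ), ‖f z i‖ ≤ ‖z‖ := fun z i => by
    rcases hinf z i with h | ⟨j, h⟩
    · simp [h]
    · rw [h]; exact lp.norm_apply_le_norm hp0 z j
  have hq : p ≠ ∞ → 0 < p.toReal := fun h => ENNReal.toReal_pos hp0 h
  have hbd : p ≠ ∞ → ∀ (z : lp (fun _ : ℕ => A) p) (s : Finset ℕ),
      ∑ i ∈ s, ‖f z i‖ ^ p.toReal ≤ ‖z‖ ^ p.toReal := fun h z s => by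
    obtain ⟨t, ht⟩ := hsum p.toReal (hq h) z s
    exact ht.trans (lp.sum_rpow_le_norm_rpow (hq h) z t)
  have hmem : ∀ z : lp (fun _ : ℕ => A) p, Memℓp (f z) p := fun z => by
    rcases eq_or_ne p ∞ with h | h
    · have : Memℓp (f z) ∞ := memℓp_infty ⟨‖z‖, by rintro _ ⟨i, rfl⟩; exact hle z i⟩
      rwa [← h] at this
    · exact memℓp_gen' (hbd h z)
  let V : lp (fun _ : ℕ => A) p →ₗ[ℝ] lp (fun _ : ℕ => A) p :=
    { toFun := fun z => ⟨f z, hmem z⟩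
      map_add' := fun z w => lp.ext (f.map_add z w)
      map_smul' := fun c z => lp.ext (f.map_smul c z) }
  refine ⟨V.mkContinuous 1 fun z => ?_, fun z i => rfl⟩
  rw [one_mul]
  rcases eq_or_ne p ∞ with h | h
  · subst h
    exact lp.norm_le_of_forall_le (norm_nonneg _) (hle z)
  · exact lp.norm_le_of_forall_sum_le (hq h) (norm_nonneg _) (hbd h z)

theorem lp.evalCLM_apply (n : ℕ) (z : lp (fun _ : ℕ => A) p) :
    lp.evalCLM ℝ (fun _ : ℕ => A) p n z = z n := rfl

/-- Pulling sequences back along an injection is bounded on `ℓ_p`. -/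
theorem lp_exists_comp {σ : ℕ → ℕ} (hσ : Function.Injective σ) :
    ∃ U : lp (fun _ : ℕ => A) p →L[ℝ] lp (fun _ : ℕ => A) p, ∀ z i, U z i = z (σ i) := by
  refine lp_exists_clm_of_sum_le (LinearMap.funLeft ℝ A σ) (fun z i => .inr ⟨σ i, rfl⟩)
    fun q _ z s => ⟨s.map ⟨σ, hσ⟩, ?_⟩
  rw [Finset.sum_map]
  rfl

/-- Pushing sequences forward along an injection, with zeros outside its range, is bounded on
`ℓ_p`. -/
theorem lp_exists_extend {σ : ℕ → ℕ} (hσ : Function.Injective σ) :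
    ∃ V : lp (fun _ : ℕ => A) p →L[ℝ] lp (fun _ : ℕ => A) p,
      (∀ z i, V z (σ i) = z i) ∧ ∀ z i, i ∉ Set.range σ → V z i = 0 := by
  have hnot : ∀ (z : ℕ → A) (i : ℕ), i ∉ Set.range σ → Function.extend σ z 0 i = 0 :=
    fun z i hi => Function.extend_apply' _ _ _ hi
  obtain ⟨V, hV⟩ := lp_exists_clm_of_sum_le (A := A) (p := p)
    { toFun := fun z => Function.extend σ z 0
      map_add' := fun z w => by simpa using Function.extend_add σ z w 0 0
      map_smul' := fun c z => by simpa using Function.extend_smul c σ z 0 }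
    (fun z i => by
      by_cases hi : i ∈ Set.range σ
      · obtain ⟨j, rfl⟩ := hi
        exact .inr ⟨j, hσ.extend_apply _ _ _⟩
      · exact .inl (hnot z i hi))
    (fun q hq z s => ⟨s.preimage σ hσ.injOn, by
      rw [← Finset.sum_preimage σ s hσ.injOn]
      · exact (Finset.sum_congr rfl fun j _ => by
          rw [LinearMap.coe_mk, AddHom.coe_mk, hσ.extend_apply]).le
      · intro i _ hi
        rw [LinearMap.coe_mk, AddHom.coe_mk, hnot z i hi, norm_zero, Real.zero_rpow hq.ne']⟩)
  exact ⟨V, fun z i => (hV _ _).trans (hσ.extend_apply _ _ _),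
    fun z i hi => (hV _ _).trans (hnot _ _ hi)⟩

theorem lp_nonempty_prod_self_equiv :
    Nonempty ((lp (fun _ : ℕ => A) p × lp (fun _ : ℕ => A) p) ≃L[ℝ] lp (fun _ : ℕ => A) p) := by
  have h0 : Function.Injective fun n : ℕ => 2 * n := fun a b h => by simpa using h
  have h1 : Function.Injective fun n : ℕ => 2 * n + 1 := fun a b h => by simpa using h
  obtain ⟨U₀, hU₀⟩ := lp_exists_comp (A := A) (p := p) h0
  obtain ⟨U₁, hU₁⟩ := lp_exists_comp (A := A) (p := p) h1
  obtain ⟨V₀, hV₀, hV₀'⟩ := lp_exists_extend (A := A) (p := p) h0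
  obtain ⟨V₁, hV₁, hV₁'⟩ := lp_exists_extend (A := A) (p := p) h1
  have odd : ∀ n, 2 * n + 1 ∉ Set.range fun n : ℕ => 2 * n := by
    rintro n ⟨m, hm⟩
    simp only at hm
    omega
  have even : ∀ n, 2 * n ∉ Set.range fun n : ℕ => 2 * n + 1 := by
    rintro n ⟨m, hm⟩
    simp only at hm
    omega
  refine ⟨ContinuousLinearEquiv.equivOfInverse (V₀.coprod V₁) (U₀.prod U₁) ?_ ?_⟩
  · rintro ⟨a, b⟩
    refine Prod.ext (lp.ext (funext fun i => ?_)) (lp.ext (funext fun i => ?_))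
    · simp [hU₀, hV₀, hV₁' _ _ (even i)]
    · simp [hU₁, hV₁, hV₀' _ _ (odd i)]
  · intro z
    refine lp.ext (funext fun i => ?_)
    rcases Nat.even_or_odd' i with ⟨k, rfl | rfl⟩
    · simp [hV₀, hV₁' _ _ (even k), hU₀]
    · simp [hV₁, hV₀' _ _ (odd k), hU₁]

theorem lp_nonempty_prod_equiv :
    Nonempty ((A × lp (fun _ : ℕ => A) p) ≃L[ℝ] lp (fun _ : ℕ => A) p) := by
  obtain ⟨U, hU⟩ := lp_exists_comp (A := A) (p := p) Nat.succ_injective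
  obtain ⟨V, hV, hV'⟩ := lp_exists_extend (A := A) (p := p) Nat.succ_injective
  have zero : 0 ∉ Set.range Nat.succ := by simp
  refine ⟨ContinuousLinearEquiv.equivOfInverse
    ((lp.singleContinuousLinearMap ℝ (fun _ : ℕ => A) p 0).coprod V)
    ((lp.evalCLM ℝ (fun _ : ℕ => A) p 0).prod U) ?_ ?_⟩
  · rintro ⟨a, b⟩
    refine Prod.ext ?_ (lp.ext (funext fun i => ?_))
    · simp [hV' _ _ zero, lp.evalCLM_apply]
    · have := hV b i
      simp_all
  · intro z
    refine lp.ext (funext fun i => ?_)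
    cases i with
    | zero => simp [hV' _ _ zero, lp.evalCLM_apply]
    | succ k =>
      have := hV (U z) k
      simp_all

/-- Pełczyński's decomposition: if `ℓ_p(A)` is isomorphic to a complemented subspace of `A`, then
`A` is isomorphic to `ℓ_p(A)`. -/
theorem nonempty_equiv_lp_of_factorization (S : lp (fun _ : ℕ => A) p →L[ℝ] A)
    (T : A →L[ℝ] lp (fun _ : ℕ => A) p) (hTS : ∀ z, T (S z) = z) :
    Nonempty (A ≃L[ℝ] lp (fun _ : ℕ => A) p) := by
  obtain ⟨e₁⟩ := lp_nonempty_prod_equiv (A := A) (p := p)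
  obtain ⟨e₂⟩ := lp_nonempty_prod_self_equiv (A := A) (p := p)
  let d := ContinuousLinearEquiv.equivOfRightInverse T S hTS
  refine ⟨ContinuousLinearEquiv.symm ?_⟩
  -- With `Z = ℓ_p(A)` and `K = ker T`: `Z ≅ A × Z ≅ (Z × K) × Z ≅ (Z × Z) × K ≅ Z × K ≅ A`.
  exact e₁.symm.trans <| (d.prodCongr (.refl ℝ _)).trans <|
    (ContinuousLinearEquiv.prodAssoc ℝ _ _ _).trans <|
    ((ContinuousLinearEquiv.refl ℝ _).prodCongr (ContinuousLinearEquiv.prodComm ℝ _ _)).trans <|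
    (ContinuousLinearEquiv.prodAssoc ℝ _ _ _).symm.trans <|
    (e₂.prodCongr (.refl ℝ _)).trans d.symm

theorem lp_infty_exists_clm {X : Type*} [NormedAddCommGroup X] [NormedSpace ℝ X] {K : ℝ}
    (T : ℕ → X →L[ℝ] A) (hT : ∀ n, ‖T n‖ ≤ K) :
    ∃ U : X →L[ℝ] lp (fun _ : ℕ => A) ∞, ∀ x n, U x n = T n x := by
  have hle : ∀ x n, ‖T n x‖ ≤ K * ‖x‖ := fun x n => (T n).le_of_opNorm_le (hT n) x
  have hK : 0 ≤ K := (norm_nonneg _).trans (hT 0)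
  let V : X →ₗ[ℝ] lp (fun _ : ℕ => A) ∞ :=
    { toFun := fun x => ⟨fun n => T n x,
        memℓp_infty ⟨K * ‖x‖, by rintro _ ⟨n, rfl⟩; exact hle x n⟩⟩
      map_add' := fun x y => lp.ext (funext fun n => (T n).map_add x y)
      map_smul' := fun c x => lp.ext (funext fun n => (T n).map_smul c x) }
  exact ⟨V.mkContinuous K fun x =>
    lp.norm_le_of_forall_le (mul_nonneg hK (norm_nonneg x)) (hle x), fun x n => rfl⟩

theorem lp_one_exists_clm {X : Type*} [NormedAddCommGroup X] [NormedSpace ℝ X] [CompleteSpace X]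
    {K : ℝ} (T : ℕ → A →L[ℝ] X) (hT : ∀ n, ‖T n‖ ≤ K) :
    ∃ U : lp (fun _ : ℕ => A) 1 →L[ℝ] X, ∀ z, HasSum (fun n => T n (z n)) (U z) := by
  have hnorm : ∀ z : lp (fun _ : ℕ => A) 1, HasSum (fun n => ‖z n‖) ‖z‖ := fun z => by
    simpa using lp.hasSum_norm (p := 1) (by simp) z
  have hle : ∀ (z : lp (fun _ : ℕ => A) 1) n, ‖T n (z n)‖ ≤ K * ‖z n‖ :=
    fun z n => (T n).le_of_opNorm_le (hT n) _
  have hs : ∀ z : lp (fun _ : ℕ => A) 1, HasSum (fun n => T n (z n)) (∑' n, T n (z n)) :=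
    fun z => (Summable.of_norm_bounded ((hnorm z).summable.mul_left K) (hle z)).hasSum
  let V : lp (fun _ : ℕ => A) 1 →ₗ[ℝ] X :=
    { toFun := fun z => ∑' n, T n (z n)
      map_add' := fun z w => by
        refine HasSum.tsum_eq ?_
        simpa using (hs z).add (hs w)
      map_smul' := fun c z => by
        refine HasSum.tsum_eq ?_
        simpa using (hs z).const_smul c }
  exact ⟨V.mkContinuous K fun z => tsum_of_norm_bounded ((hnorm z).mul_left K) (hle z), hs⟩

end SequenceSpaces

/-! ### Cutoff functions and gluing of Lipschitz maps -/

section Gluing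

variable {M : Type*} [MetricSpace M]

/-- The radial cutoff that is `1` on `B(z, r)` and `0` outside `B(z, 2r)`, linear in between. -/
def bump (z : M) (r : ℝ) (x : M) : ℝ := max 0 (min 1 (2 - dist x z / r))

theorem bump_nonneg (z : M) (r : ℝ) (x : M) : 0 ≤ bump z r x := le_max_left _ _

theorem bump_le_one (z : M) (r : ℝ) (x : M) : bump z r x ≤ 1 :=
  max_le zero_le_one (min_le_left _ _)

theorem bump_eq_one {z x : M} {r : ℝ} (hr : 0 < r) (h : dist x z ≤ r) : bump z r x = 1 := by
  have : dist x z / r ≤ 1 := (div_le_one hr).2 h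
  rw [bump, min_eq_left (by linarith), max_eq_right zero_le_one]

theorem bump_eq_zero {z x : M} {r : ℝ} (hr : 0 < r) (h : 2 * r ≤ dist x z) : bump z r x = 0 := by
  have : 2 ≤ dist x z / r := (le_div_iff₀ hr).2 h
  rw [bump, min_eq_right (by linarith), max_eq_left (by linarith)]

theorem abs_bump_sub_le (z : M) {r : ℝ} (hr : 0 < r) (x y : M) :
    |bump z r x - bump z r y| ≤ r⁻¹ * dist x y := by
  refine (abs_max_sub_max_le_max _ _ _ _).trans ?_
  rw [sub_self, abs_zero, max_eq_right (abs_nonneg _)]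
  refine (abs_min_sub_min_le_max _ _ _ _).trans ?_
  rw [sub_self, abs_zero, max_eq_right (abs_nonneg _), sub_sub_sub_cancel_left, ← sub_div,
    abs_div, abs_of_pos hr, div_eq_inv_mul, dist_comm x y]
  gcongr
  exact abs_dist_sub_le y x z

/-- The dyadic partition of unity around `o`: the `k`-th weight is supported in the shell
`2^(k-1) ≤ d(x, o) ≤ 2^(k+1)`, and the weight of index `0` in the ball `B(o, 2)`. -/
def shellWeight (o : M) : ℕ → M → ℝ
  | 0 => bump o (2 ^ 0)
  | k + 1 => fun x => bump o (2 ^ (k + 1)) x - bump o (2 ^ k) x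

theorem sum_shellWeight (o : M) (x : M) (n : ℕ) :
    ∑ k ∈ Finset.range (n + 1), shellWeight o k x = bump o (2 ^ n) x := by
  induction n with
  | zero => simp [shellWeight]
  | succ n ih => rw [Finset.sum_range_succ, ih, shellWeight]; ring

theorem shellWeight_eq_zero {o x : M} {k : ℕ} (h : 2 ^ (k + 1) ≤ dist x o) :
    shellWeight o k x = 0 := by
  cases k with
  | zero => exact bump_eq_zero (by positivity) (by simpa using h)
  | succ k =>
    have h2 : (2 : ℝ) * 2 ^ (k + 1) ≤ dist x o := by rwa [← pow_succ']
    have h1 : (2 : ℝ) * 2 ^ k ≤ dist x o := by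
      rw [← pow_succ']
      exact (pow_le_pow_right₀ one_le_two (Nat.le_succ _)).trans h
    simp only [shellWeight]
    rw [bump_eq_zero (by positivity) h2, bump_eq_zero (by positivity) h1, sub_zero]

theorem shellWeight_succ_eq_zero {o x : M} {k : ℕ} (h : dist x o ≤ 2 ^ k) :
    shellWeight o (k + 1) x = 0 := by
  have h2 : dist x o ≤ 2 ^ (k + 1) := h.trans (pow_le_pow_right₀ one_le_two (Nat.le_succ _))
  simp only [shellWeight]
  rw [bump_eq_one (by positivity) h2, bump_eq_one (by positivity) h, sub_self]

theorem abs_shellWeight_le_one (o : M) (k : ℕ) (x : M) : |shellWeight o k x| ≤ 1 := by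
  have h := fun r => bump_nonneg o r x
  have h' := fun r => bump_le_one o r x
  cases k with
  | zero => exact (abs_of_nonneg (h (2 ^ 0))).trans_le (h' _)
  | succ k =>
    rw [shellWeight, abs_le]
    constructor <;> linarith [h (2 ^ k), h (2 ^ (k + 1)), h' (2 ^ k), h' (2 ^ (k + 1))]

theorem abs_shellWeight_sub_le (o : M) (k : ℕ) (x y : M) :
    |shellWeight o k x - shellWeight o k y| ≤ 3 * (2 ^ k)⁻¹ * dist x y := by
  cases k with
  | zero =>
    refine (abs_bump_sub_le o (by positivity) x y).trans ?_
    gcongr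
    norm_num
  | succ k =>
    have h1 := abs_bump_sub_le o (r := 2 ^ (k + 1)) (by positivity) x y
    have h2 := abs_bump_sub_le o (r := 2 ^ k) (by positivity) x y
    have h3 : ((2 : ℝ) ^ k)⁻¹ = 2 * (2 ^ (k + 1))⁻¹ := by rw [pow_succ]; field_simp
    rw [h3] at h2
    simp only [shellWeight]
    rw [sub_sub_sub_comm]
    refine (abs_sub _ _).trans ?_
    linarith

variable {Y : Type*} [NormedAddCommGroup Y]

/-- A sum of uniformly Lipschitz maps of which at most `N` are nonzero at each point is
Lipschitz. -/
theorem norm_finsum_sub_finsum_le {ι : Type*} {h : ι → M → Y} {L : ℝ} {N : ℕ} (hL : 0 ≤ L)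
    (hh : ∀ i x y, ‖h i x - h i y‖ ≤ L * dist x y)
    (hs : ∀ x, ∃ s : Finset ι, s.card ≤ N ∧ ∀ i ∉ s, h i x = 0) (x y : M) :
    ‖∑ᶠ i, h i x - ∑ᶠ i, h i y‖ ≤ 2 * N * L * dist x y := by
  classical
  obtain ⟨s, hsN, hs0⟩ := hs x
  obtain ⟨t, htN, ht0⟩ := hs y
  have hx : ∑ᶠ i, h i x = ∑ i ∈ s ∪ t, h i x :=
    finsum_eq_sum_of_support_subset _ fun i hi => by
      by_contra hc
      exact hi (hs0 i fun h' => hc (by simp [h']))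
  have hy : ∑ᶠ i, h i y = ∑ i ∈ s ∪ t, h i y :=
    finsum_eq_sum_of_support_subset _ fun i hi => by
      by_contra hc
      exact hi (ht0 i fun h' => hc (by simp [h']))
  have hcard : ((s ∪ t).card : ℝ) ≤ 2 * N := by
    have := Finset.card_union_le s t
    exact_mod_cast (by omega : (s ∪ t).card ≤ 2 * N)
  rw [hx, hy, ← Finset.sum_sub_distrib]
  calc ‖∑ i ∈ s ∪ t, (h i x - h i y)‖ ≤ ∑ i ∈ s ∪ t, L * dist x y :=
        norm_sum_le_of_le _ fun i _ => hh i x y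
    _ = (s ∪ t).card * (L * dist x y) := by rw [Finset.sum_const, nsmul_eq_mul]
    _ ≤ 2 * N * (L * dist x y) := by gcongr
    _ = _ := by ring

variable [NormedSpace ℝ Y]

/-- Cutting off a Lipschitz map `v` with `v z = 0` by a `K`-Lipschitz function supported in `B(z, R)`
costs only the factor `K * R + 1`: on the support `‖v‖ ≤ L * R`. If one of the two points lies
outside the support, the estimate is made at the other one, so nothing is assumed about paths
in `M`. -/
theorem norm_smul_sub_smul_le {a : M → ℝ} {v : M → Y} {z : M} {K L R : ℝ} (hK : 0 ≤ K)
    (ha1 : ∀ x, |a x| ≤ 1) (ha : ∀ x y, |a x - a y| ≤ K * dist x y)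
    (ha0 : ∀ x, R ≤ dist x z → a x = 0) (hv : ∀ x y, ‖v x - v y‖ ≤ L * dist x y) (hvz : v z = 0)
    (hL : 0 ≤ L) (hR : 0 ≤ R) (x y : M) :
    ‖a x • v x - a y • v y‖ ≤ (K * R + 1) * L * dist x y := by
  have key : ∀ x y, dist x z ≤ R → ‖a x • v x - a y • v y‖ ≤ (K * R + 1) * L * dist x y := by
    intro x y hx
    have h1 : ‖v x‖ ≤ L * R := by
      have := hv x z
      rw [hvz, sub_zero] at this
      exact this.trans (by gcongr)
    calc ‖a x • v x - a y • v y‖ = ‖(a x - a y) • v x + a y • (v x - v y)‖ := by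
          congr 1; rw [sub_smul, smul_sub]; abel
      _ ≤ |a x - a y| * ‖v x‖ + |a y| * ‖v x - v y‖ := by
          refine (norm_add_le _ _).trans ?_
          rw [norm_smul, norm_smul, Real.norm_eq_abs, Real.norm_eq_abs]
      _ ≤ (K * dist x y) * (L * R) + 1 * (L * dist x y) := by
          gcongr
          exacts [ha x y, ha1 y, hv x y]
      _ = _ := by ring
  rcases le_total (dist x z) R with hx | hx
  · exact key x y hx
  · rcases le_total (dist y z) R with hy | hy
    · rw [norm_sub_rev, dist_comm]
      exact key y x hy
    · rw [ha0 x hx, ha0 y hy]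
      simp only [zero_smul, sub_zero, norm_zero]
      positivity

/-- The maps `v k`, glued by the dyadic partition of unity around `o`. At each point at most two
terms of the sum are nonzero, so the `finsum` takes no junk value. -/
def shellGlue (o : M) (v : ℕ → M → Y) (x : M) : Y := ∑ᶠ k, shellWeight o k x • v k x

theorem exists_shellWeight_support (o x : M) :
    ∃ n : ℕ, dist x o ≤ 2 ^ (n + 1) ∧ ∀ k ∉ ({n, n + 1} : Finset ℕ), shellWeight o k x = 0 := by
  classical
  have hex : ∃ n : ℕ, dist x o ≤ 2 ^ (n + 1) := by
    obtain ⟨n, hn⟩ := pow_unbounded_of_one_lt (dist x o) one_lt_two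
    exact ⟨n, hn.le.trans (pow_le_pow_right₀ one_le_two (Nat.le_succ _))⟩
  refine ⟨Nat.find hex, Nat.find_spec hex, fun k hk => ?_⟩
  simp only [Finset.mem_insert, Finset.mem_singleton, not_or] at hk
  rcases lt_or_ge k (Nat.find hex) with h | h
  · exact shellWeight_eq_zero (not_le.1 (Nat.find_min hex h)).le
  · obtain ⟨l, rfl⟩ : ∃ l, k = l + 1 := ⟨k - 1, by omega⟩
    exact shellWeight_succ_eq_zero ((Nat.find_spec hex).trans
      (pow_le_pow_right₀ one_le_two (by omega)))

theorem norm_shellGlue_sub_le {o : M} {v : ℕ → M → Y} {L : ℝ} (hL : 0 ≤ L)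
    (hv : ∀ k x y, ‖v k x - v k y‖ ≤ L * dist x y) (hv0 : ∀ k, v k o = 0) (x y : M) :
    ‖shellGlue o v x - shellGlue o v y‖ ≤ 28 * L * dist x y := by
  rw [show 28 * L * dist x y = 2 * (2 : ℕ) * (7 * L) * dist x y by push_cast; ring]
  refine norm_finsum_sub_finsum_le (h := fun k x => shellWeight o k x • v k x) (by positivity)
    (fun k x y => ?_) (fun x => ?_) x y
  · refine (norm_smul_sub_smul_le (K := 3 * (2 ^ k)⁻¹) (R := 2 ^ (k + 1)) (by positivity)
      (abs_shellWeight_le_one o k) (abs_shellWeight_sub_le o k)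
      (fun x hx => shellWeight_eq_zero hx) (hv k) (hv0 k) hL (by positivity) x y).trans_eq ?_
    rw [pow_succ]
    field_simp
    ring
  · obtain ⟨n, -, hn⟩ := exists_shellWeight_support o x
    exact ⟨{n, n + 1}, Finset.card_le_two, fun k hk => by rw [hn k hk, zero_smul]⟩

theorem shellGlue_base {o : M} {v : ℕ → M → Y} (hv0 : ∀ k, v k o = 0) : shellGlue o v o = 0 := by
  simp [shellGlue, hv0]

/-- A linear map that takes the same value at `v k x` for all `k` with `x ∈ B(o, 2^(k+1))` takes that
value at the glued map, since the weights sum to `1`. -/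
theorem map_shellGlue {W : Type*} [AddCommGroup W] [Module ℝ W] (T : Y →ₗ[ℝ] W) {o : M}
    {v : ℕ → M → Y} {x : M} {w : W} (h : ∀ k, dist x o ≤ 2 ^ (k + 1) → T (v k x) = w) :
    T (shellGlue o v x) = w := by
  obtain ⟨n, hn, hn0⟩ := exists_shellWeight_support o x
  have hsub : ({n, n + 1} : Finset ℕ) ⊆ Finset.range (n + 1 + 1) := by
    intro k hk
    simp only [Finset.mem_insert, Finset.mem_singleton] at hk
    rw [Finset.mem_range]
    omega
  have h0 : ∀ k ∉ Finset.range (n + 1 + 1), shellWeight o k x = 0 := fun k hk =>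
    hn0 k fun h => hk (hsub h)
  have heq : shellGlue o v x = ∑ k ∈ Finset.range (n + 1 + 1), shellWeight o k x • v k x :=
    finsum_eq_sum_of_support_subset _ fun k hk => by
      by_contra hc
      exact hk (by simp only [h0 k hc, zero_smul])
  rw [heq, map_sum]
  calc ∑ k ∈ Finset.range (n + 1 + 1), T (shellWeight o k x • v k x)
      = ∑ k ∈ Finset.range (n + 1 + 1), shellWeight o k x • w := by
        refine Finset.sum_congr rfl fun k _ => ?_
        rw [map_smul]
        rcases le_total (dist x o) (2 ^ (k + 1)) with hk | hk
        · rw [h k hk]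
        · rw [shellWeight_eq_zero hk, zero_smul, zero_smul]
    _ = w := by
        rw [← Finset.sum_smul, sum_shellWeight, bump_eq_one (by positivity) hn, one_smul]

/-- An unbounded homogeneous space has isometries that carry `o` to the centres of pairwise disjoint
balls of prescribed radii, none of which contains `o`. -/
theorem exists_scattered_isometries (hhom : IsMetricallyHomogeneous M)
    (hunb : ¬ Bornology.IsBounded (Set.univ : Set M)) (o : M) (R : ℕ × ℕ → ℝ) (hR : ∀ p, 0 < R p) :
    ∃ φ : ℕ × ℕ → M ≃ᵢ M, (∀ p, R p ≤ dist o (φ p o)) ∧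
      ∀ x p q, dist x (φ p o) < R p → dist x (φ q o) < R q → p = q := by
  have far : ∀ t : ℝ, ∃ z : M, t < dist z o := by
    intro t
    by_contra! hc
    exact hunb (Metric.isBounded_closedBall.subset (t := Metric.closedBall o t)
      fun x _ => Metric.mem_closedBall.2 (hc x))
  choose f hf using far
  let S : ℕ → ℝ := fun j => R (Nat.unpair j)
  -- The centres leave `o` so fast that the balls lie in disjoint shells around `o`.
  let w : ℕ → M := fun j => Nat.rec (f (S 0)) (fun i z => f (dist z o + S i + S (i + 1))) j
  have hw : ∀ j, dist (w j) o + S j + S (j + 1) < dist (w (j + 1)) o := fun j => hf _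
  have hS : ∀ j, 0 < S j := fun j => hR _
  have hw0 : ∀ j, S j ≤ dist (w j) o := by
    intro j
    cases j with
    | zero => exact (hf (S 0)).le
    | succ j => linarith [hw j, hS j, dist_nonneg (x := w j) (y := o)]
  have hmono : StrictMono fun j => dist (w j) o + S j :=
    strictMono_nat_of_lt_succ fun j => by linarith [hw j, hS (j + 1)]
  have hsep : ∀ i j, i < j → dist (w i) o + S i ≤ dist (w j) o - S j := by
    intro i j hij
    obtain ⟨l, rfl⟩ : ∃ l, j = l + 1 := ⟨j - 1, by omega⟩
    have := hmono.monotone (show i ≤ l by omega)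
    linarith [hw l]
  have hdisj : ∀ x i j, dist x (w i) < S i → dist x (w j) < S j → ¬ i < j := by
    intro x i j hi hj hij
    have h1 := dist_triangle x (w i) o
    have h2 := dist_triangle_left (w j) o x
    linarith [hsep i j hij]
  choose φ hφ using fun p : ℕ × ℕ => hhom o (w (Nat.pair p.1 p.2))
  have hSp : ∀ p : ℕ × ℕ, S (Nat.pair p.1 p.2) = R p := fun p => by simp [S]
  refine ⟨φ, fun p => ?_, fun x p q hp hq => ?_⟩
  · rw [hφ, dist_comm, ← hSp]
    exact hw0 _
  · rw [hφ, ← hSp] at hp hq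
    have h := le_antisymm (not_lt.1 (hdisj x _ _ hq hp)) (not_lt.1 (hdisj x _ _ hp hq))
    have := congrArg Nat.unpair h
    simpa using this

end Gluing

/-! ### Operators given by Lipschitz kernels, and the Lipschitz-free space -/

section Dual

-- Needed for instance search on iterated duals.
set_option maxSynthPendingDepth 3

variable {M : Type*} [MetricSpace M] {o : M}

theorem LipZero.delta_apply (x : M) (f : LipZero M o) : LipZero.delta o x f = f x := rfl

theorem LipZero.delta_base : LipZero.delta o o = 0 :=
  ContinuousLinearMap.ext fun f => f.apply_base

theorem LipZero.norm_delta_sub_le (x y : M) :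
    ‖LipZero.delta o x - LipZero.delta o y‖ ≤ dist x y :=
  ContinuousLinearMap.opNorm_le_bound _ dist_nonneg fun f => by
    rw [mul_comm]
    exact f.abs_sub_le x y

/-- A Lipschitz map `s : M → Z*` that vanishes at `o` is the kernel of an operator `Z → Lip₀(M)`. -/
theorem LipZero.exists_of_kernel {Z : Type*} [NormedAddCommGroup Z] [NormedSpace ℝ Z] {L : ℝ}
    (hL : 0 ≤ L) (s : M → StrongDual ℝ Z) (hs : ∀ x y, ‖s x - s y‖ ≤ L * dist x y)
    (hs0 : s o = 0) :
    ∃ T : Z →L[ℝ] LipZero M o, ‖T‖ ≤ L ∧ ∀ z x, T z x = s x z := by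
  have hz : ∀ z x y, |s x z - s y z| ≤ L * ‖z‖ * dist x y := fun z x y => by
    have := (s x - s y).le_of_opNorm_le (hs x y) z
    rw [sub_apply, Real.norm_eq_abs] at this
    linarith
  let T : Z →ₗ[ℝ] LipZero M o :=
    { toFun := fun z => LipZero.of (fun x => s x z)
        ⟨(L * ‖z‖).toNNReal, LipschitzWith.of_dist_le_mul fun x y => by
          rw [Real.coe_toNNReal _ (by positivity), Real.dist_eq]
          exact hz z x y⟩
        (by rw [hs0]; rfl)
      map_add' := fun z w => LipZero.ext fun x => (s x).map_add z w
      map_smul' := fun c z => LipZero.ext fun x => (s x).map_smul c z }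
  exact ⟨T.mkContinuous L fun z => LipZero.norm_le_of (by positivity) (hz z),
    T.mkContinuous_norm_le hL _, fun z x => rfl⟩

/-- Composition with a nonexpansive map `ψ : N → M`, normalized to vanish at the base point of `N`. -/
theorem LipZero.exists_restrict {N : Type*} [MetricSpace N] (p : N) (ψ : N → M)
    (hψ : ∀ x y, dist (ψ x) (ψ y) ≤ dist x y) :
    ∃ T : LipZero M o →L[ℝ] LipZero N p, ‖T‖ ≤ 1 ∧ ∀ f x, T f x = f (ψ x) - f (ψ p) := by
  obtain ⟨T, hT, hTs⟩ := LipZero.exists_of_kernel (o := p) zero_le_one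
    (fun x => LipZero.delta o (ψ x) - LipZero.delta o (ψ p))
    (fun x y => by
      rw [sub_sub_sub_cancel_right, one_mul]
      exact (LipZero.norm_delta_sub_le _ _).trans (hψ x y)) (sub_self _)
  exact ⟨T, hT, hTs⟩

namespace LipschitzFree

/-- The evaluation functional at `x`, as an element of the Lipschitz-free space. -/
def delta (o x : M) : LipschitzFree M o :=
  ⟨LipZero.delta o x,
    Submodule.le_topologicalClosure _ (Submodule.subset_span (Set.mem_range_self x))⟩

theorem delta_base : delta o o = 0 := Subtype.ext LipZero.delta_base

theorem norm_delta_sub_le (x y : M) : ‖delta o x - delta o y‖ ≤ dist x y :=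
  LipZero.norm_delta_sub_le x y

theorem clm_ext {Y : Type*} [NormedAddCommGroup Y] [NormedSpace ℝ Y]
    {S T : LipschitzFree M o →L[ℝ] Y} (h : ∀ x, S (delta o x) = T (delta o x)) : S = T := by
  let P := Submodule.span ℝ (Set.range (LipZero.delta o : M → StrongDual ℝ (LipZero M o)))
  have key : ∀ v (hv : v ∈ P),
      S ⟨v, P.le_topologicalClosure hv⟩ = T ⟨v, P.le_topologicalClosure hv⟩ := by
    intro v hv
    induction hv using Submodule.span_induction with
    | mem v hv => obtain ⟨x, rfl⟩ := hv; exact h x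
    | zero => exact (S.map_zero).trans T.map_zero.symm
    | add v w hv hw ihv ihw =>
      exact (S.map_add ⟨v, P.le_topologicalClosure hv⟩ ⟨w, P.le_topologicalClosure hw⟩).trans
        ((congrArg₂ _ ihv ihw).trans (T.map_add _ _).symm)
    | smul c v hv ih =>
      exact (S.map_smul c ⟨v, P.le_topologicalClosure hv⟩).trans
        ((congrArg _ ih).trans (T.map_smul c _).symm)
  have hd : Dense {v : LipschitzFree M o | (v : StrongDual ℝ (LipZero M o)) ∈ P} := by
    intro v
    rw [closure_subtype]
    refine closure_mono ?_ v.2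
    exact fun w hw => ⟨⟨w, P.le_topologicalClosure hw⟩, hw, rfl⟩
  have := Continuous.ext_on hd S.continuous T.continuous fun v hv => key v hv
  exact ContinuousLinearMap.ext fun v => congrFun this v

/-- The universal property of the Lipschitz-free space. The lift is built into the bidual of `Y`, as
the adjoint of `y* ↦ y* ∘ f`. It sends evaluations into the image of `Y`, which is closed because
`Y` is complete. -/
theorem exists_lift {Y : Type*} [NormedAddCommGroup Y] [NormedSpace ℝ Y] [CompleteSpace Y]
    {L : ℝ} (hL : 0 ≤ L) (f : M → Y) (hf : ∀ x y, ‖f x - f y‖ ≤ L * dist x y) (hf0 : f o = 0) :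
    ∃ T : LipschitzFree M o →L[ℝ] Y, ‖T‖ ≤ L ∧ ∀ x, T (delta o x) = f x := by
  let J := NormedSpace.inclusionInDoubleDualLi ℝ (E := Y)
  obtain ⟨Φ, hΦ, hΦs⟩ := LipZero.exists_of_kernel (o := o) hL (fun x => J (f x))
    (fun x y => by rw [← map_sub, J.norm_map]; exact hf x y) (by rw [hf0, map_zero])
  have hadj : ∀ x, (LipZero.delta o x).comp Φ = J (f x) := fun x =>
    ContinuousLinearMap.ext fun z => hΦs z x
  let D : StrongDual ℝ (LipZero M o) →L[ℝ] StrongDual ℝ (StrongDual ℝ Y) :=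
    ContinuousLinearMap.precomp ℝ Φ
  let Q : Submodule ℝ (StrongDual ℝ (StrongDual ℝ Y)) := LinearMap.range J.toLinearMap
  have hQ : IsClosed (Q : Set (StrongDual ℝ (StrongDual ℝ Y))) := by
    change IsClosed (Set.range J)
    exact J.isometry.isClosedEmbedding.isClosed_range
  have hmem : ∀ μ : LipschitzFree M o, D μ ∈ Q := fun μ => by
    have hle : (Submodule.span ℝ (Set.range
        (LipZero.delta o : M → StrongDual ℝ (LipZero M o)))).topologicalClosure ≤ Q.comap D.toLinearMap := by
      refine Submodule.topologicalClosure_minimal _ (Submodule.span_le.2 ?_)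
        (hQ.preimage D.continuous)
      rintro _ ⟨x, rfl⟩
      exact ⟨f x, (hadj x).symm⟩
    exact hle μ.2
  let e : Y ≃ₗᵢ[ℝ] Q := J.equivRange
  let D' : LipschitzFree M o →L[ℝ] Q := (D.comp (Submodule.subtypeL _)).codRestrict Q hmem
  refine ⟨(e.symm : Q →L[ℝ] Y).comp D', ContinuousLinearMap.opNorm_le_bound _ hL fun μ => ?_,
    fun x => ?_⟩
  · calc ‖e.symm (D' μ)‖ = ‖(μ : StrongDual ℝ (LipZero M o)).comp Φ‖ := e.symm.norm_map _
      _ ≤ ‖μ‖ * ‖Φ‖ := ContinuousLinearMap.opNorm_comp_le _ _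
      _ ≤ L * ‖μ‖ := by rw [mul_comm]; gcongr
  · change e.symm (D' (delta o x)) = f x
    rw [LinearIsometryEquiv.symm_apply_eq]
    exact Subtype.ext (hadj x)

end LipschitzFree

/-- A functional on `Lip₀(M)` that is small on the functions of the unit ball vanishing on suitable
finite sets belongs to the Lipschitz-free space. On the subspace `N` of functions vanishing on the
finite set it has norm at most `ε`; after subtraction of a Hahn-Banach extension `ψ` of its
restriction to `N` it vanishes on `N`, hence is a combination of evaluations. -/
theorem mem_lipschitzFree_of_small (φ : StrongDual ℝ (LipZero M o))
    (hφ : ∀ ε > 0, ∃ F : Finset M, ∀ f : LipZero M o, ‖f‖ ≤ 1 → (∀ x ∈ F, f x = 0) → |φ f| ≤ ε) :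
    φ ∈ (Submodule.span ℝ
      (Set.range (LipZero.delta o : M → StrongDual ℝ (LipZero M o)))).topologicalClosure := by
  rw [← SetLike.mem_coe, Submodule.topologicalClosure_coe, Metric.mem_closure_iff]
  intro ε hε
  obtain ⟨F, hF⟩ := hφ (ε / 2) (half_pos hε)
  let N : Submodule ℝ (LipZero M o) := ⨅ x : F, (LipZero.delta o (x : M)).toLinearMap.ker
  have hN : ∀ f, f ∈ N ↔ ∀ x ∈ F, f x = 0 := fun f => by
    simp [N, Submodule.mem_iInf, LipZero.delta_apply]
  obtain ⟨ψ, hψ, hψn⟩ := exists_extension_norm_eq N (φ.comp N.subtypeL)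
  have hnorm : ‖ψ‖ ≤ ε / 2 := by
    rw [hψn]
    refine ContinuousLinearMap.opNorm_le_of_unit_norm (half_pos hε).le fun f hf => ?_
    exact hF f hf.le ((hN f).1 f.2)
  refine ⟨φ - ψ, ?_, ?_⟩
  · have hmem := mem_span_of_iInf_ker_le_ker
      (L := fun x : F => (LipZero.delta o (x : M)).toLinearMap)
      (K := (φ - ψ).toLinearMap) (fun f hf => by
        have h := hψ ⟨f, hf⟩
        rw [LinearMap.mem_ker]
        change φ f - ψ f = 0
        rw [h]
        exact sub_self _)
    obtain ⟨c, hc⟩ := (Submodule.mem_span_range_iff_exists_fun ℝ).1 hmem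
    have hsum : φ - ψ = ∑ x : F, c x • LipZero.delta o (x : M) := by
      refine ContinuousLinearMap.ext fun f => ?_
      have := LinearMap.congr_fun hc f
      simpa using this.symm
    rw [hsum]
    exact Submodule.sum_mem _ fun x _ =>
      Submodule.smul_mem _ _ (Submodule.subset_span (Set.mem_range_self _))
  · rw [dist_eq_norm, sub_sub_cancel]
    linarith

theorem IsWeakStarContinuous.exists_finset {N : Type*} [MetricSpace N] {p : N}
    {E : LipZero M o →L[ℝ] LipZero N p} (hE : IsWeakStarContinuous E) (y : N) {ε : ℝ} (hε : 0 < ε) :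
    ∃ F : Finset M, ∀ f : LipZero M o, ‖f‖ ≤ 1 → (∀ x ∈ F, f x = 0) → |E f y| ≤ ε := by
  have hev : @Continuous _ _ (LipZero.pointwiseTopology N p) _ (fun g : LipZero N p => g y) :=
    @Continuous.comp _ _ _ (LipZero.pointwiseTopology N p) _ _ _ _
      (continuous_apply y) continuous_induced_dom
  have hcont : @ContinuousOn _ _ (LipZero.pointwiseTopology M o) _
      (fun f : LipZero M o => E f y) {f | ‖f‖ ≤ 1} :=
    @Continuous.comp_continuousOn _ _ _ (LipZero.pointwiseTopology M o)
      (LipZero.pointwiseTopology N p) _ _ _ _ hev hE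
  have h0 := hcont 0 (by simp)
  have hnhds : {t : ℝ | |t| < ε} ∈ nhds (E (0 : LipZero M o) y) := by
    rw [map_zero, LipZero.zero_apply]
    exact (isOpen_lt continuous_abs continuous_const).mem_nhds (by simpa using hε)
  obtain ⟨u, hu, hu0, hsub⟩ := (@mem_nhdsWithin _ (LipZero.pointwiseTopology M o) _ _ _).1
    (h0 hnhds)
  obtain ⟨V, hV, rfl⟩ := isOpen_induced_iff.1 hu
  obtain ⟨F, v, hv, hvV⟩ := isOpen_pi_iff.1 hV _ hu0
  refine ⟨F, fun f hf hfF => le_of_lt (hsub ⟨hvV fun x hx => ?_, hf⟩)⟩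
  have h := (hv x hx).2
  change f x ∈ v x
  rw [hfF x hx]
  exact h

end Dual

/-! ### Kernels of the extension operators, and the factorizations -/

section Kernels

-- Needed for instance search on iterated duals.
set_option maxSynthPendingDepth 3

variable {M : Type*} [MetricSpace M] {o : M}

/-- The kernel of the operator that transports a function from `B(o, r)` to `B(φ o, r)`, extends it to
`M` and cuts it off outside `B(φ o, 2r)`. If the extension operator is weak* continuous, the kernel
takes its values in the Lipschitz-free space. -/
theorem exists_ball_kernel {C r : ℝ} (hC : 0 ≤ C) (hr : 0 < r) (φ : M ≃ᵢ M)
    {s : Metric.closedBall (φ o) r}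
    (E : LipZero (Metric.closedBall (φ o) r) s →L[ℝ] LipZero M (s : M))
    (hE : IsExtensionOperator E) (hEC : ‖E‖ ≤ C) :
    ∃ e : M → StrongDual ℝ (LipZero M o),
      (∀ x y, ‖e x - e y‖ ≤ 3 * C * dist x y) ∧
      (∀ x, 2 * r ≤ dist x (φ o) → e x = 0) ∧
      (∀ y, dist y o ≤ r → e (φ y) = LipZero.delta o y) ∧
      (IsWeakStarContinuous E → ∀ x, e x ∈ (Submodule.span ℝ
        (Set.range (LipZero.delta o : M → StrongDual ℝ (LipZero M o)))).topologicalClosure) := by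
  classical
  obtain ⟨R, hR, hRs⟩ := LipZero.exists_restrict (o := o) s (fun y => φ.symm (y : M))
    (fun x y => (φ.symm.dist_eq _ _).le)
  -- The base point `s` of the ball need not be its centre, so the value at `s` is subtracted
  -- before the extension and added afterwards.
  let u : M → StrongDual ℝ (LipZero M o) := fun x =>
    (LipZero.delta (s : M) x).comp (E.comp R) + LipZero.delta o (φ.symm s)
  have hu : ∀ x y, ‖u x - u y‖ ≤ C * dist x y := fun x y => by
    have h1 : ‖E.comp R‖ ≤ C * 1 :=
      (E.opNorm_comp_le R).trans (mul_le_mul hEC hR (norm_nonneg _) hC)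
    rw [add_sub_add_right_eq_sub, ← ContinuousLinearMap.sub_comp]
    refine (ContinuousLinearMap.opNorm_comp_le _ _).trans ?_
    rw [mul_comm, ← mul_one C]
    exact mul_le_mul h1 (LipZero.norm_delta_sub_le x y) (norm_nonneg _) (by linarith)
  have huball : ∀ y, dist y o ≤ r → u (φ y) = LipZero.delta o y := fun y hy => by
    have hmem : φ y ∈ Metric.closedBall (φ o) r := by
      rwa [Metric.mem_closedBall, φ.dist_eq]
    refine ContinuousLinearMap.ext fun g => ?_
    change E (R g) (φ y) + g (φ.symm s) = g y
    rw [hE (R g) ⟨φ y, hmem⟩, hRs, φ.symm_apply_apply, sub_add_cancel]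
  have hu0 : u (φ o) = 0 := by
    rw [huball o (by simpa using hr.le), LipZero.delta_base]
  refine ⟨fun x => bump (φ o) r x • u x, fun x y => ?_, fun x hx => ?_, fun y hy => ?_,
    fun hW x => Submodule.smul_mem _ _ (Submodule.add_mem _ ?_ (LipschitzFree.delta o _).2)⟩
  · refine (norm_smul_sub_smul_le (inv_nonneg.2 hr.le)
      (fun x => (abs_of_nonneg (bump_nonneg _ _ x)).trans_le (bump_le_one _ _ x))
      (abs_bump_sub_le (φ o) hr) (fun x => bump_eq_zero hr) hu hu0 hC (by positivity)
      x y).trans_eq ?_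
    field_simp
    ring
  · simp only [bump_eq_zero hr hx, zero_smul]
  · have h1 : bump (φ o) r (φ y) = 1 := bump_eq_one hr (by rwa [φ.dist_eq])
    simp only [h1, one_smul, huball y hy]
  · refine mem_lipschitzFree_of_small _ fun ε hε => ?_
    obtain ⟨F, hF⟩ := hW.exists_finset x hε
    refine ⟨insert (φ.symm (s : M)) (F.image fun y : Metric.closedBall (φ o) r =>
      φ.symm (y : M)), fun f hf hf0 => ?_⟩
    refine hF (R f) ((R.le_of_opNorm_le hR f).trans (by linarith)) fun y hy => ?_
    rw [hRs, hf0 _ (Finset.mem_insert_of_mem (Finset.mem_image_of_mem _ hy)),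
      hf0 _ (Finset.mem_insert_self _ _), sub_zero]

/-- Given the kernels of single balls, with values in a subspace `W`, kernels `e (n, k)` with disjoint
supports for balls of radius `2^(k+1)` scattered in `M`. Disjointness is also stated at the points
`φ p y` of the balls themselves, because `e p (φ p o) = δ(o) = 0`. -/
theorem exists_scattered_kernels (hhom : IsMetricallyHomogeneous M)
    (hunb : ¬ Bornology.IsBounded (Set.univ : Set M)) {L : ℝ}
    {W : Submodule ℝ (StrongDual ℝ (LipZero M o))}
    (H : ∀ (φ : M ≃ᵢ M) (r : ℝ), 0 < r → ∃ e : M → StrongDual ℝ (LipZero M o),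
      (∀ x y, ‖e x - e y‖ ≤ L * dist x y) ∧
      (∀ x, 2 * r ≤ dist x (φ o) → e x = 0) ∧
      (∀ y, dist y o ≤ r → e (φ y) = LipZero.delta o y) ∧ ∀ x, e x ∈ W) :
    ∃ (φ : ℕ × ℕ → M ≃ᵢ M) (e : ℕ × ℕ → M → StrongDual ℝ (LipZero M o)),
      (∀ p x y, ‖e p x - e p y‖ ≤ L * dist x y) ∧ (∀ p, e p o = 0) ∧
      (∀ x p q, e p x ≠ 0 → e q x ≠ 0 → p = q) ∧
      (∀ p y, dist y o ≤ 2 ^ (p.2 + 1) → e p (φ p y) = LipZero.delta o y) ∧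
      (∀ p q y, dist y o ≤ 2 ^ (p.2 + 1) → q ≠ p → e q (φ p y) = 0) ∧
      ∀ p x, e p x ∈ W := by
  obtain ⟨φ, hφo, hφ⟩ := exists_scattered_isometries hhom hunb o
    (fun p => 2 * 2 ^ (p.2 + 1)) (fun p => by positivity)
  choose e he hsupp hball hW using fun p : ℕ × ℕ => H (φ p) (2 ^ (p.2 + 1)) (by positivity)
  have hlt : ∀ p x, e p x ≠ 0 → dist x (φ p o) < 2 * 2 ^ (p.2 + 1) := fun p x hx =>
    lt_of_not_ge fun h => hx (hsupp p x h)
  refine ⟨φ, e, he, fun p => hsupp p o (hφo p),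
    fun x p q hp hq => hφ x p q (hlt p x hp) (hlt q x hq), hball, fun p q y hy hqp => ?_, hW⟩
  by_contra hne
  refine hqp (hφ _ q p (hlt q _ hne) ?_)
  rw [(φ p).dist_eq]
  have : (0 : ℝ) < 2 ^ (p.2 + 1) := by positivity
  linarith

/-- A sum of Lipschitz maps with disjoint supports is Lipschitz. -/
theorem norm_finsum_map_sub_le {ι V Y : Type*} [NormedAddCommGroup V] [NormedSpace ℝ V]
    [NormedAddCommGroup Y] [NormedSpace ℝ Y] {L : ℝ} (hL : 0 ≤ L) {e : ι → M → V}
    (he : ∀ i x y, ‖e i x - e i y‖ ≤ L * dist x y)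
    (hdisj : ∀ x i j, e i x ≠ 0 → e j x ≠ 0 → i = j)
    (B : ι → V →ₗ[ℝ] Y) (hB : ∀ i v, ‖B i v‖ ≤ ‖v‖) (x y : M) :
    ‖∑ᶠ i, B i (e i x) - ∑ᶠ i, B i (e i y)‖ ≤ 2 * L * dist x y := by
  rw [show 2 * L * dist x y = 2 * (1 : ℕ) * L * dist x y by simp]
  refine norm_finsum_sub_finsum_le (h := fun i x => B i (e i x)) hL (fun i x y => ?_)
    (fun x => ?_) x y
  · rw [← map_sub]
    exact (hB i _).trans (he i x y)
  · by_cases h : ∃ i, e i x ≠ 0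
    · obtain ⟨i, hi⟩ := h
      refine ⟨{i}, by simp, fun j hj => ?_⟩
      have : e j x = 0 := by
        by_contra hne
        exact hj (Finset.mem_singleton.2 (hdisj x j i hne hi))
      rw [this, map_zero]
    · push Not at h
      exact ⟨∅, by simp, fun j _ => by rw [h j, map_zero]⟩

theorem lipZero_nonempty_equiv (hhom : IsMetricallyHomogeneous M)
    (hunb : ¬ Bornology.IsBounded (Set.univ : Set M)) {C : ℝ} (hC : 0 ≤ C)
    (H : ∀ (x : M) (r : ℝ), 0 < r → IsLipschitzExtendable C (Metric.closedBall x r)) :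
    Nonempty (LipZero M o ≃L[ℝ] lp (fun _ : ℕ => LipZero M o) ∞) := by
  obtain ⟨φ, e, he, he0, hdisj, hball, hother, -⟩ := exists_scattered_kernels (o := o)
    (W := ⊤) (L := 3 * C) hhom hunb fun φ r hr => by
      obtain ⟨s, E, hE, hEC⟩ := H (φ o) r hr
      obtain ⟨e, h1, h2, h3, -⟩ := exists_ball_kernel hC hr φ E hE hEC
      exact ⟨e, h1, h2, h3, fun x => Submodule.mem_top⟩
  let B : ℕ × ℕ → StrongDual ℝ (LipZero M o) →ₗ[ℝ]
      StrongDual ℝ (lp (fun _ : ℕ => LipZero M o) ∞) := fun p =>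
    (ContinuousLinearMap.precomp ℝ (lp.evalCLM ℝ (fun _ : ℕ => LipZero M o) ∞ p.1)).toLinearMap
  have hB : ∀ p v, ‖B p v‖ ≤ ‖v‖ := fun p v => by
    refine ContinuousLinearMap.opNorm_le_bound _ (norm_nonneg v) fun z => ?_
    exact (v.le_opNorm _).trans
      (mul_le_mul_of_nonneg_left (lp.norm_apply_le_norm ENNReal.top_ne_zero z p.1) (norm_nonneg v))
  let s : M → StrongDual ℝ (lp (fun _ : ℕ => LipZero M o) ∞) := fun x => ∑ᶠ p, B p (e p x)
  obtain ⟨S, -, hS⟩ := LipZero.exists_of_kernel (o := o) (L := 2 * (3 * C)) (by positivity) s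
    (norm_finsum_map_sub_le (by positivity) he hdisj B hB) (by simp [s, he0])
  -- On the ball of index `(n, k)`, the function `S z` is the transported `z n`.
  have hsball : ∀ p z y, dist y o ≤ 2 ^ (p.2 + 1) → S z (φ p y) = z p.1 y := fun p z y hy => by
    have : s (φ p y) = B p (e p (φ p y)) := finsum_eq_single _ p fun q hq => by
      rw [hother p q y hy hq, map_zero]
    rw [hS, this, hball p y hy]
    rfl
  let t : ℕ → M → StrongDual ℝ (LipZero M o) := fun n => shellGlue o fun k x =>
    LipZero.delta o (φ (n, k) x) - LipZero.delta o (φ (n, k) o)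
  choose T hTn hT using fun n => LipZero.exists_of_kernel (o := o) (L := 28 * 1) (by positivity)
    (t n) (norm_shellGlue_sub_le zero_le_one (fun k x y => by
      rw [sub_sub_sub_cancel_right, one_mul, ← (φ (n, k)).dist_eq]
      exact LipZero.norm_delta_sub_le _ _) (fun k => sub_self _))
    (shellGlue_base fun k => sub_self _)
  obtain ⟨U, hU⟩ := lp_infty_exists_clm T hTn
  refine nonempty_equiv_lp_of_factorization S U fun z => lp.ext (funext fun n => ?_)
  refine LipZero.ext fun x => ?_
  rw [hU, hT]
  refine map_shellGlue (ContinuousLinearMap.apply ℝ ℝ (S z)).toLinearMap fun k hk => ?_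
  change S z (φ (n, k) x) - S z (φ (n, k) o) = z n x
  rw [hsball (n, k) z x hk, hsball (n, k) z o (by simp), LipZero.apply_base, sub_zero]

universe u

/-- `δ : M → V` has the universal property of the Lipschitz-free space, with respect to target spaces
in the universe of `V`: it is nonexpansive, vanishes at `o`, and Lipschitz maps into Banach spaces
that vanish at `o` factor uniquely through operators of no larger norm. -/
structure IsLipschitzUniversal {V : Type u} [NormedAddCommGroup V] [NormedSpace ℝ V] (o : M)
    (δ : M → V) : Prop where
  base : δ o = 0
  norm_sub_le (x y : M) : ‖δ x - δ y‖ ≤ dist x y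
  clm_ext {Y : Type u} [NormedAddCommGroup Y] [NormedSpace ℝ Y] {S T : V →L[ℝ] Y} :
    (∀ x, S (δ x) = T (δ x)) → S = T
  exists_lift {Y : Type u} [NormedAddCommGroup Y] [NormedSpace ℝ Y] [CompleteSpace Y] {L : ℝ} :
    0 ≤ L → ∀ f : M → Y, (∀ x y, ‖f x - f y‖ ≤ L * dist x y) → f o = 0 →
      ∃ T : V →L[ℝ] Y, ‖T‖ ≤ L ∧ ∀ x, T (δ x) = f x

/-- If the ball `B(o, 2^(k+1))` is transported by isometries `φ (n, k)` to scattered balls in `M`, and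
`V`-valued maps `e (n, k)` with disjoint supports carry the inverse transport on these balls, then
`V` is isomorphic to `ℓ₁(V)`: the maps `e` give an operator `Q : V → ℓ₁(V)`, and gluing the
translates `δ ∘ φ (n, k)` over `k` gives its right inverse. -/
theorem IsLipschitzUniversal.nonempty_equiv_lp_one {V : Type u} [NormedAddCommGroup V]
    [NormedSpace ℝ V] [CompleteSpace V] {δ : M → V} (hδ : IsLipschitzUniversal o δ) {L : ℝ}
    (hL : 0 ≤ L) {φ : ℕ × ℕ → M ≃ᵢ M} {e : ℕ × ℕ → M → V}
    (he : ∀ p x y, ‖e p x - e p y‖ ≤ L * dist x y) (he0 : ∀ p, e p o = 0)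
    (hdisj : ∀ x p q, e p x ≠ 0 → e q x ≠ 0 → p = q)
    (hball : ∀ p y, dist y o ≤ 2 ^ (p.2 + 1) → e p (φ p y) = δ y)
    (hother : ∀ p q y, dist y o ≤ 2 ^ (p.2 + 1) → q ≠ p → e q (φ p y) = 0) :
    Nonempty (V ≃L[ℝ] lp (fun _ : ℕ => V) 1) := by
  let B : ℕ × ℕ → V →ₗ[ℝ] lp (fun _ : ℕ => V) 1 := fun p =>
    lp.lsingle (E := fun _ : ℕ => V) 1 p.1
  have hB : ∀ p v, ‖B p v‖ ≤ ‖v‖ := fun p v =>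
    (lp.norm_single (E := fun _ : ℕ => V) zero_lt_one p.1 v).le
  let s : M → lp (fun _ : ℕ => V) 1 := fun x => ∑ᶠ p, B p (e p x)
  obtain ⟨Q, -, hQ⟩ := hδ.exists_lift (L := 2 * L) (by positivity) s
    (norm_finsum_map_sub_le hL he hdisj B hB) (by simp [s, he0])
  -- On the ball of index `(n, k)`, the map `s` is the transported `δ` in the `n`-th coordinate.
  have hsball : ∀ p y, dist y o ≤ 2 ^ (p.2 + 1) →
      s (φ p y) = lp.single 1 p.1 (δ y) := fun p y hy => by
    have h1 : s (φ p y) = B p (e p (φ p y)) := finsum_eq_single _ p fun q hq => by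
      rw [hother p q y hy hq, map_zero]
    rw [h1, hball p y hy]
    rfl
  let t : ℕ → M → V := fun n => shellGlue o fun k x => δ (φ (n, k) x) - δ (φ (n, k) o)
  choose T hTn hT using fun n => hδ.exists_lift (L := 28 * 1) (by positivity)
    (t n) (norm_shellGlue_sub_le zero_le_one (fun k x y => by
      rw [sub_sub_sub_cancel_right, one_mul, ← (φ (n, k)).dist_eq]
      exact hδ.norm_sub_le _ _) (fun k => sub_self _))
    (shellGlue_base fun k => sub_self _)
  have hQT : ∀ n, Q.comp (T n) =
      lp.singleContinuousLinearMap ℝ (fun _ : ℕ => V) 1 n := fun n => by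
    refine hδ.clm_ext fun x => ?_
    change Q (T n (δ x)) = lp.single 1 n (δ x)
    rw [hT]
    refine map_shellGlue Q.toLinearMap fun k hk => ?_
    change Q (δ (φ (n, k) x) - δ (φ (n, k) o)) = _
    rw [map_sub, hQ, hQ, hsball (n, k) x hk, hsball (n, k) o (by simp), hδ.base,
      lp.single_zero, sub_zero]
  obtain ⟨J, hJ⟩ := lp_one_exists_clm T hTn
  refine nonempty_equiv_lp_of_factorization J Q fun z => ?_
  have h := (hJ z).mapL Q
  have h' : (fun n => Q (T n (z n))) = fun n => lp.single 1 n (z n) := funext fun n =>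
    DFunLike.congr_fun (hQT n) (z n)
  rw [h'] at h
  exact h.unique (lp.hasSum_single ENNReal.one_ne_top z)

theorem LipschitzFree.isLipschitzUniversal_delta :
    IsLipschitzUniversal o (LipschitzFree.delta o) where
  base := delta_base
  norm_sub_le := norm_delta_sub_le
  clm_ext := clm_ext
  exists_lift := exists_lift

theorem lipschitzFree_nonempty_equiv (hhom : IsMetricallyHomogeneous M)
    (hunb : ¬ Bornology.IsBounded (Set.univ : Set M)) {C : ℝ} (hC : 0 ≤ C)
    (H : ∀ (x : M) (r : ℝ), 0 < r → IsWeakStarLipschitzExtendable C (Metric.closedBall x r)) :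
    Nonempty (LipschitzFree M o ≃L[ℝ] lp (fun _ : ℕ => LipschitzFree M o) 1) := by
  obtain ⟨φ, e, he, he0, hdisj, hball, hother, hW⟩ := exists_scattered_kernels (o := o)
    (L := 3 * C) hhom hunb fun φ r hr => by
      obtain ⟨s, E, hE, hEw, hEC⟩ := H (φ o) r hr
      obtain ⟨e, h1, h2, h3, h4⟩ := exists_ball_kernel hC hr φ E hE hEC
      exact ⟨e, h1, h2, h3, h4 hEw⟩
  let e' : ℕ × ℕ → M → LipschitzFree M o := fun p x => ⟨e p x, hW p x⟩
  have he' : ∀ p x, e' p x = 0 ↔ e p x = 0 := fun p x => Subtype.ext_iff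
  exact LipschitzFree.isLipschitzUniversal_delta.nonempty_equiv_lp_one (L := 3 * C)
    (by positivity) (e := e') (fun p x y => he p x y) (fun p => (he' p o).2 (he0 p))
    (fun x p q hp hq => hdisj x p q (mt (he' p x).2 hp) (mt (he' q x).2 hq))
    (fun p y hy => Subtype.ext (hball p y hy))
    (fun p q y hy hq => (he' q _).2 (hother p q y hy hq))

end Kernels

end

theorem theorem3p2 {M : Type*} [MetricSpace M] (o : M)
    (hhom : IsMetricallyHomogeneous M)
    (hunb : ¬ Bornology.IsBounded (Set.univ : Set M)) :
    ((∃ C : ℝ, 1 ≤ C ∧ ∀ (x : M) (r : ℝ), 0 < r →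
        IsWeakStarLipschitzExtendable C (Metric.closedBall x r)) →
      Nonempty (LipschitzFree M o ≃L[ℝ] lp (fun _ : ℕ => LipschitzFree M o) 1)) ∧
    ((∃ C : ℝ, 1 ≤ C ∧ ∀ (x : M) (r : ℝ), 0 < r →
        IsLipschitzExtendable C (Metric.closedBall x r)) →
      Nonempty (LipZero M o ≃L[ℝ] lp (fun _ : ℕ => LipZero M o) ∞)) :=
  ⟨fun ⟨_, hC, H⟩ => lipschitzFree_nonempty_equiv hhom hunb (zero_le_one.trans hC) H,
    fun ⟨_, hC, H⟩ => lipZero_nonempty_equiv hhom hunb (zero_le_one.trans hC) H⟩
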